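/- Let $v_p$ denote the $p$-adic valuation, with $v_p(p)=1$ and $v_p(0)=\infty$, extended to algebraic extensions of $\mathbb{Q}_p$ by $v_p(a)=\frac1d v_p(a_0)$ when $a$ has minimal polynomial $x^d+\dots+a_0$ over $\mathbb{Q}_p$. Let $A\in\mathbb{Z}^{n\times n}$ have rank $r$, Smith form $\mathrm{diag}(s_1,\dots,s_r,0,\dots,0)$ over $\mathbb{Z}$ (so $s_i>0$ and $s_1\mid s_2\mid\dots\mid s_r$) and characteristic polynomial $x^n+f_1x^{n-1}+\dots+f_n$. Call $A$ *$p$-characterized* if $v_p(f_k)=v_p(s_1s_2\cdots s_k)$ for all $1\le k\le r$. Call $A$ *$p$-correspondent* if $A$ has exactly $r$ non-zero eigenvalues $\lambda_1,\dots,\lambda_r$ in an algebraic closure of $\mathbb{Q}_p$, counted with algebraic multiplicity, and, when these are ordered so that $v_p(\lambda_1)\le\dots\le v_p(\lambda_r)$, one has $v_p(s_i)=v_p(\lambda_i)$ for all $1\le i\le r$. **Theorem.** Let $n$ be a positive integer, let $\epsilon>0$ be real, and let $p$ be a prime with $p>16(n^2+3n)/\epsilon$. Let $0\le e_1\le e_2\le\dots\le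 e_n$ be integers, let $m\ge e_1+\dots+e_n+1$ be an integer, and put $S=\mathrm{diag}(p^{e_1},\dots,p^{e_n})$. Let $\mathcal{S}_S^m$ be the set of all matrices in $\mathbb{Z}^{n\times n}$ with entries in $[0,p^m)$ whose Smith form $\mathrm{diag}(s_1,\dots,s_n)$ over $\mathbb{Z}$ satisfies $v_p(s_i)=e_i$ for all $1\le i\le n$. Then every $p$-characterized matrix in $\mathcal{S}_S^m$ is $p$-correspondent, and the number of matrices in $\mathcal{S}_S^m$ that are $p$-characterized, and hence $p$-correspondent, is at least $(1-\epsilon)\cdot|\mathcal{S}_S^m|$. -/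

import Mathlib

/-- `s` lists the diagonal entries of the Smith form over `ℤ` of the integer matrix `A`:
`A = U * diagonal s * V` with `U`, `V` unimodular, the entries being nonnegative and each one
dividing the later ones, so that zero entries (if any) come last.
Such an `s` exists for every `A` and is unique. -/
def IsSmithForm {n : ℕ} (A : Matrix (Fin n) (Fin n) ℤ) (s : Fin n → ℤ) : Prop :=
  (∀ i, 0 ≤ s i) ∧ (∀ i j, i ≤ j → s i ∣ s j) ∧
    ∃ U V : Matrix (Fin n) (Fin n) ℤ, IsUnit U.det ∧ IsUnit V.det ∧
      A = U * Matrix.diagonal s * V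

/-- The `p`-adic valuation of an element `a` of an algebraic extension of `ℚ_p`, normalised by
`v_p(p) = 1`: if `a` has minimal polynomial `x ^ d + ⋯ + a₀` over `ℚ_p`, then
`v_p(a) = v_p(a₀) / d`. It is used only for `a ≠ 0`. -/
noncomputable def padicOrd (p : ℕ) [Fact p.Prime] {K : Type*} [Field K] [Algebra ℚ_[p] K]
    (a : K) : ℚ :=
  (((minpoly ℚ_[p] a).coeff 0).valuation : ℚ) / ((minpoly ℚ_[p] a).natDegree : ℚ)

/-- `A` is `p`-characterized: with `r` the rank of `A`, with `s` its Smith form and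
`x ^ n + f₁ x ^ (n - 1) + ⋯ + fₙ` its characteristic polynomial, `v_p(f_k) = v_p(s₁ ⋯ s_k)` for
all `1 ≤ k ≤ r`. Here `v_p` on `ℤ` is `emultiplicity`, which takes the value `∞` at `0`. -/
def IsPCharacterized (p : ℕ) {n : ℕ} (A : Matrix (Fin n) (Fin n) ℤ) : Prop :=
  ∃ s : Fin n → ℤ, IsSmithForm A s ∧
    ∀ k : ℕ, 1 ≤ k → k ≤ A.rank →
      emultiplicity (p : ℤ) (A.charpoly.coeff (n - k)) =
        emultiplicity (p : ℤ) (∏ i ∈ Finset.univ.filter (fun i : Fin n => (i : ℕ) < k), s i)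

open Classical in
/-- `A` is `p`-correspondent: `A` has exactly `r = rank A` nonzero eigenvalues `lam₁, …, lamᵣ`
(counted with algebraic multiplicity) in an algebraic closure of `ℚ_p`, and, when they are listed
with nondecreasing valuations, `v_p(s_i) = v_p(lam_i)` for all `1 ≤ i ≤ r`, where `s` is the Smith
form of `A` (so `s_i ≠ 0` for `i ≤ r`). -/
def IsPCorrespondent (p : ℕ) [Fact p.Prime] {n : ℕ} (A : Matrix (Fin n) (Fin n) ℤ) : Prop :=
  ∃ s : Fin n → ℤ, IsSmithForm A s ∧
    ∃ lam : Fin A.rank → AlgebraicClosure ℚ_[p],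
      Multiset.map lam Finset.univ.val =
        (A.charpoly.aroots (AlgebraicClosure ℚ_[p])).filter (fun x => x ≠ 0) ∧
      (∀ i j, i ≤ j → padicOrd p (lam i) ≤ padicOrd p (lam j)) ∧
      ∀ i : Fin A.rank,
        (padicValInt p (s (Fin.castLE A.rank_le_width i)) : ℚ) = padicOrd p (lam i)

/-- The set of integer `n × n` matrices with entries in `[0, p ^ m)` whose Smith form
`diag(s₁, …, sₙ)` satisfies `v_p(s_i) = e_i` for all `i`. -/
def smithClass (p m : ℕ) {n : ℕ} (e : Fin n → ℕ) : Set (Matrix (Fin n) (Fin n) ℤ) :=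
  {A | (∀ i j, 0 ≤ A i j ∧ A i j < (p : ℤ) ^ m) ∧
    ∃ s : Fin n → ℤ, IsSmithForm A s ∧ ∀ i, emultiplicity (p : ℤ) (s i) = (e i : ℕ∞)}

/-- The class is finite, so that `Set.ncard` is its true number of elements. -/
theorem smithClass_finite (p m : ℕ) {n : ℕ} (e : Fin n → ℕ) : (smithClass p m e).Finite := by
  have h : (Set.Icc (fun _ _ => 0 : Fin n → Fin n → ℤ) (fun _ _ => (p : ℤ) ^ m)).Finite :=
    Set.finite_Icc _ _
  exact h.subset fun A hA => ⟨fun i j => (hA.1 i j).1, fun i j => (hA.1 i j).2.le⟩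

/-! Reduce modulo `p ^ m`. Since every `e i` is less than `m`, the reductions of the matrices in the
class form exactly one orbit `u S v`, with `S` the diagonal matrix of the `p ^ e i` and `u`, `v`
invertible over `ZMod (p ^ m)` (`smithClass_eq_image`). A uniform pair `(u, v)` gives a uniform
point of the orbit, so it suffices to count pairs.

The matrices `u S v` and `S (v u)` have the same characteristic polynomial. With `W = v u`, its
coefficient of index `n - k` is, up to sign, `p ^ (e₁ + ⋯ + e_k)` times a weighted sum of the
principal `k`-minors of `W`. This exponent is less than `m`, so the valuation of an integer lift is
the required one as soon as the weighted sum is nonzero modulo `p`. That sum is a nonzero polynomial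
of degree at most `k` in the entries of `W`, so by Schwartz–Zippel it vanishes for a proportion at
most `k / p` of all matrices. Summing over `k ≤ n` bounds the bad matrices by `n ^ 2 / p ≤ ε`. The
good ones are all invertible (take `k = n`), so their share among the invertible matrices is only
larger.

That characterized implies correspondent is the Newton polygon argument, carried by Gauss norms. For
every radius `c`, multiplicativity gives the norm of the characteristic polynomial as the product of
the `max c ‖lam i‖`, and the coefficients give it as the product of the `max c (p⁻¹ ^ e i)`. These
functions of `c` determine the sorted sequences (`eq_of_prod_max_eq`). -/

/-- Equivalence of integer matrices under multiplication by unimodular matrices. -/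
def UnimodularEquiv {n : ℕ} (A B : Matrix (Fin n) (Fin n) ℤ) : Prop :=
  ∃ P Q : Matrix (Fin n) (Fin n) ℤ, IsUnit P ∧ IsUnit Q ∧ B = P * A * Q

namespace UnimodularEquiv

variable {n : ℕ} {A B C : Matrix (Fin n) (Fin n) ℤ}

theorem refl (A : Matrix (Fin n) (Fin n) ℤ) : UnimodularEquiv A A :=
  ⟨1, 1, isUnit_one, isUnit_one, by simp⟩

theorem trans (h₁ : UnimodularEquiv A B) (h₂ : UnimodularEquiv B C) : UnimodularEquiv A C := by
  obtain ⟨P, Q, hP, hQ, rfl⟩ := h₁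
  obtain ⟨P', Q', hP', hQ', rfl⟩ := h₂
  exact ⟨P' * P, Q * Q', hP'.mul hP, hQ.mul hQ', by simp only [Matrix.mul_assoc]⟩

theorem symm (h : UnimodularEquiv A B) : UnimodularEquiv B A := by
  obtain ⟨P, Q, hP, hQ, rfl⟩ := h
  obtain ⟨P, rfl⟩ := hP
  obtain ⟨Q, rfl⟩ := hQ
  refine ⟨↑P⁻¹, ↑Q⁻¹, P⁻¹.isUnit, Q⁻¹.isUnit, ?_⟩
  rw [← Matrix.mul_assoc, ← Matrix.mul_assoc, Units.inv_mul, Matrix.one_mul, Matrix.mul_assoc,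
    Units.mul_inv, Matrix.mul_one]

theorem mul_left {P : Matrix (Fin n) (Fin n) ℤ} (hP : IsUnit P) : UnimodularEquiv A (P * A) :=
  ⟨P, 1, hP, isUnit_one, by simp⟩

theorem mul_right {Q : Matrix (Fin n) (Fin n) ℤ} (hQ : IsUnit Q) : UnimodularEquiv A (A * Q) :=
  ⟨1, Q, isUnit_one, hQ, by simp⟩

theorem dvd (h : UnimodularEquiv A B) {d : ℤ} (hd : ∀ i j, d ∣ A i j) (i j : Fin n) :
    d ∣ B i j := by
  obtain ⟨P, Q, -, -, rfl⟩ := h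
  simp only [Matrix.mul_apply]
  exact Finset.dvd_sum fun k _ => Dvd.dvd.mul_right
    (Finset.dvd_sum fun l _ => Dvd.dvd.mul_left (hd _ _) _) _

theorem submatrix_perm (σ τ : Equiv.Perm (Fin n)) : UnimodularEquiv A (A.submatrix σ τ) := by
  have h (ρ : Equiv.Perm (Fin n)) : IsUnit ((1 : Matrix (Fin n) (Fin n) ℤ).submatrix ρ id) := by
    rw [Matrix.isUnit_iff_isUnit_det, Matrix.det_permute]
    simp
  have h' (ρ : Equiv.Perm (Fin n)) : IsUnit ((1 : Matrix (Fin n) (Fin n) ℤ).submatrix id ρ) := by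
    rw [Matrix.isUnit_iff_isUnit_det, Matrix.det_permute']
    simp
  refine ⟨_, _, h σ, h' τ, ?_⟩
  ext i j
  simp [Matrix.mul_apply, Matrix.one_apply, Finset.sum_ite_eq]

end UnimodularEquiv

/-! ### Existence of the Smith form over `ℤ` -/

section SmithForm

variable {n : ℕ}

theorem isUnit_transvection {i j : Fin n} (h : i ≠ j) (c : ℤ) :
    IsUnit (Matrix.transvection i j c) := by
  rw [Matrix.isUnit_iff_isUnit_det, Matrix.det_transvection_of_ne _ _ h]
  exact isUnit_one

/-- Every nonzero integer matrix is equivalent to one whose corner entry is positive and minimal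
in absolute value among all nonzero entries of equivalent matrices. -/
theorem exists_equiv_minimal_corner (A : Matrix (Fin (n + 1)) (Fin (n + 1)) ℤ) (hA : A ≠ 0) :
    ∃ B, UnimodularEquiv A B ∧ 0 < B 0 0 ∧
      ∀ C, UnimodularEquiv B C → ∀ i j, C i j ≠ 0 → B 0 0 ≤ |C i j| := by
  classical
  have hex : ∃ d : ℕ, ∃ B, UnimodularEquiv A B ∧ ∃ i j, B i j ≠ 0 ∧ (B i j).natAbs = d := by
    by_contra! h
    exact hA (by
      ext i j
      by_contra hij
      exact h _ A (.refl A) i j hij rfl)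
  obtain ⟨B, hAB, i, j, hne, hd⟩ := Nat.find_spec hex
  have hmin : ∀ C, UnimodularEquiv A C → ∀ k l, C k l ≠ 0 → |B i j| ≤ |C k l| := by
    intro C hC k l hkl
    have := Nat.find_min' hex ⟨C, hC, k, l, hkl, rfl⟩
    rw [Int.abs_eq_natAbs, Int.abs_eq_natAbs, hd]
    exact_mod_cast this
  have hB' : UnimodularEquiv A (B.submatrix (Equiv.swap 0 i) (Equiv.swap 0 j)) :=
    hAB.trans (.submatrix_perm _ _)
  rcases lt_or_gt_of_ne hne with h | h
  · have hneg : UnimodularEquiv A (-1 * B.submatrix (Equiv.swap 0 i) (Equiv.swap 0 j)) :=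
      hB'.trans (.mul_left isUnit_one.neg)
    have h00 : (-1 * B.submatrix (Equiv.swap 0 i) (Equiv.swap 0 j)) 0 0 = -B i j := by simp
    refine ⟨_, hneg, by rw [h00]; omega, fun C hC k l hkl => ?_⟩
    rw [h00, ← abs_of_neg h]
    exact hmin C (hneg.trans hC) k l hkl
  · have h00 : (B.submatrix (Equiv.swap 0 i) (Equiv.swap 0 j)) 0 0 = B i j := by simp
    refine ⟨_, hB', by rw [h00]; omega, fun C hC k l hkl => ?_⟩
    rw [h00, ← abs_of_pos h]
    exact hmin C (hB'.trans hC) k l hkl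

/-- A column operation replaces the entry by its remainder modulo the corner; a nonzero remainder
would contradict minimality. -/
theorem corner_dvd_row {B : Matrix (Fin (n + 1)) (Fin (n + 1)) ℤ} (hpos : 0 < B 0 0)
    (hmin : ∀ C, UnimodularEquiv B C → ∀ i j, C i j ≠ 0 → B 0 0 ≤ |C i j|) (j : Fin (n + 1)) :
    B 0 0 ∣ B 0 j := by
  by_cases hj : j = 0
  · rw [hj]
  have h := hmin _ (.mul_right (isUnit_transvection (Ne.symm hj) (-(B 0 j / B 0 0)))) 0 j
  rw [Matrix.mul_transvection_apply_same] at h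
  have hm : B 0 j + -(B 0 j / B 0 0) * B 0 0 = B 0 j % B 0 0 := by
    rw [Int.emod_def]; ring
  rw [hm] at h
  by_contra hnd
  have h0 : B 0 j % B 0 0 ≠ 0 := fun h0 => hnd (Int.dvd_of_emod_eq_zero h0)
  have h1 := h h0
  rw [abs_of_nonneg (Int.emod_nonneg _ hpos.ne')] at h1
  exact absurd (Int.emod_lt_of_pos (B 0 j) hpos) (not_lt.2 h1)

theorem corner_dvd_column {B : Matrix (Fin (n + 1)) (Fin (n + 1)) ℤ} (hpos : 0 < B 0 0)
    (hmin : ∀ C, UnimodularEquiv B C → ∀ i j, C i j ≠ 0 → B 0 0 ≤ |C i j|) (i : Fin (n + 1)) :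
    B 0 0 ∣ B i 0 := by
  by_cases hi : i = 0
  · rw [hi]
  have h := hmin _ (.mul_left (isUnit_transvection hi (-(B i 0 / B 0 0)))) i 0
  rw [Matrix.transvection_mul_apply_same] at h
  have hm : B i 0 + -(B i 0 / B 0 0) * B 0 0 = B i 0 % B 0 0 := by
    rw [Int.emod_def]; ring
  rw [hm] at h
  by_contra hnd
  have h0 : B i 0 % B 0 0 ≠ 0 := fun h0 => hnd (Int.dvd_of_emod_eq_zero h0)
  have h1 := h h0
  rw [abs_of_nonneg (Int.emod_nonneg _ hpos.ne')] at h1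
  exact absurd (Int.emod_lt_of_pos (B i 0) hpos) (not_lt.2 h1)

/-- The rank-one matrix has square zero. -/
theorem isUnit_one_sub_vecMulVec {u v : Fin n → ℤ} (h : v ⬝ᵥ u = 0) :
    IsUnit (1 - Matrix.vecMulVec u v) := by
  apply IsNilpotent.isUnit_one_sub
  refine ⟨2, ?_⟩
  rw [pow_two, Matrix.vecMulVec_mul_vecMulVec, h]
  ext i j
  simp [Matrix.vecMulVec_apply]

/-- Every integer matrix is equivalent to one whose corner entry is nonnegative and divides all
entries, the other entries of the first row and column being zero. -/
theorem exists_equiv_corner_block (A : Matrix (Fin (n + 1)) (Fin (n + 1)) ℤ) :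
    ∃ B, UnimodularEquiv A B ∧ 0 ≤ B 0 0 ∧ (∀ i j, B 0 0 ∣ B i j) ∧
      (∀ j : Fin n, B 0 j.succ = 0) ∧ ∀ i : Fin n, B i.succ 0 = 0 := by
  by_cases hA : A = 0
  · exact ⟨A, .refl A, by simp [hA]⟩
  obtain ⟨B, hAB, hpos, hmin⟩ := exists_equiv_minimal_corner A hA
  choose q hq using corner_dvd_row hpos hmin
  choose r hr using corner_dvd_column hpos hmin
  -- Setting the quotient at index `0` to zero leaves the corner untouched and makes the rank-one
  -- matrix nilpotent.
  have hU : IsUnit (1 - Matrix.vecMulVec (Function.update r 0 0) (Pi.single (0 : Fin (n + 1)) (1 : ℤ))) :=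
    isUnit_one_sub_vecMulVec (by simp)
  have hV : IsUnit (1 - Matrix.vecMulVec (Pi.single (0 : Fin (n + 1)) (1 : ℤ)) (Function.update q 0 0)) :=
    isUnit_one_sub_vecMulVec (by simp)
  set C := (1 - Matrix.vecMulVec (Function.update r 0 0) (Pi.single (0 : Fin (n + 1)) (1 : ℤ))) * B *
    (1 - Matrix.vecMulVec (Pi.single (0 : Fin (n + 1)) (1 : ℤ)) (Function.update q 0 0)) with hC
  have hBC : UnimodularEquiv B C := ⟨_, _, hU, hV, rfl⟩
  have hCij (i j) : C i j = B i j - Function.update r 0 0 i * B 0 j -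
      (B i 0 - Function.update r 0 0 i * B 0 0) * Function.update q 0 0 j := by
    simp only [hC, Matrix.mul_sub, Matrix.sub_mul, Matrix.one_mul, Matrix.mul_one,
      Matrix.sub_apply, Matrix.vecMulVec_mul, Matrix.mul_vecMulVec, Matrix.vecMulVec_apply,
      Matrix.mulVec_single_one, Matrix.single_one_vecMul, Matrix.col_apply, Matrix.row_apply]
  have hC00 : C 0 0 = B 0 0 := by simp [hCij]
  have hrow (j : Fin n) : C 0 j.succ = 0 := by simp [hCij, hq j.succ]
  have hcol (i : Fin n) : C i.succ 0 = 0 := by simp [hCij, hr i.succ, mul_comm]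
  refine ⟨C, hAB.trans hBC, by rw [hC00]; exact hpos.le, fun i j => ?_, hrow, hcol⟩
  refine Fin.cases ?_ (fun i => ?_) i
  · refine Fin.cases dvd_rfl (fun j => ?_) j
    rw [hrow]
    exact dvd_zero _
  -- Adding row `i.succ` to row `0` keeps the corner, because column `0` is already cleared, and
  -- moves the entries of row `i.succ` into row `0`, where `corner_dvd_row` applies again.
  · have hCD : UnimodularEquiv C (Matrix.transvection (0 : Fin (n + 1)) i.succ (1 : ℤ) * C) :=
      .mul_left (isUnit_transvection (Fin.succ_ne_zero i).symm 1)
    have hD00 : (Matrix.transvection (0 : Fin (n + 1)) i.succ (1 : ℤ) * C) 0 0 = B 0 0 := by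
      rw [Matrix.transvection_mul_apply_same, hcol, hC00]; simp
    have := corner_dvd_row (B := Matrix.transvection (0 : Fin (n + 1)) i.succ (1 : ℤ) * C) (by rwa [hD00])
      (by rw [hD00]; exact fun E hE => hmin E ((hBC.trans hCD).trans hE)) j
    rw [hD00, Matrix.transvection_mul_apply_same, one_mul] at this
    rw [hC00]
    refine (dvd_add_right ?_).1 this
    refine Fin.cases (by rw [hC00]) (fun j => ?_) j
    rw [hrow]
    exact dvd_zero _

/-- The block matrix with blocks `d` and `M` on the diagonal. -/
def cornerBlock (d : ℤ) (M : Matrix (Fin n) (Fin n) ℤ) : Matrix (Fin (n + 1)) (Fin (n + 1)) ℤ :=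
  Matrix.of fun i j =>
    Fin.cases (motive := fun _ => ℤ) (Fin.cases (motive := fun _ => ℤ) d (fun _ => 0) j)
      (fun i' => Fin.cases (motive := fun _ => ℤ) 0 (fun j' => M i' j') j) i

theorem cornerBlock_mul (c d : ℤ) (M N : Matrix (Fin n) (Fin n) ℤ) :
    cornerBlock c M * cornerBlock d N = cornerBlock (c * d) (M * N) := by
  ext i j
  refine Fin.cases ?_ (fun i => ?_) i <;> refine Fin.cases ?_ (fun j => ?_) j <;>
    simp [Matrix.mul_apply, Fin.sum_univ_succ, cornerBlock]

theorem cornerBlock_diagonal (d : ℤ) (s : Fin n → ℤ) :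
    cornerBlock d (Matrix.diagonal s) = Matrix.diagonal (Fin.cons d s) := by
  ext i j
  refine Fin.cases ?_ (fun i => ?_) i <;> refine Fin.cases ?_ (fun j => ?_) j <;>
    simp [Matrix.diagonal_apply, cornerBlock, (Fin.succ_ne_zero _).symm]

theorem isUnit_cornerBlock {M : Matrix (Fin n) (Fin n) ℤ} (h : IsUnit M) :
    IsUnit (cornerBlock 1 M) := by
  obtain ⟨M, rfl⟩ := h
  have h1 : cornerBlock 1 (1 : Matrix (Fin n) (Fin n) ℤ) = 1 := by
    rw [← Matrix.diagonal_one, cornerBlock_diagonal, ← Matrix.diagonal_one]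
    congr 1
    ext i
    refine Fin.cases ?_ (fun i => ?_) i <;> simp
  refine ⟨⟨cornerBlock 1 M, cornerBlock 1 ↑M⁻¹, ?_, ?_⟩, rfl⟩ <;>
    simp [cornerBlock_mul, h1]

/-- Induction on the size. The corner divides every entry of the remaining block, and equivalence
preserves this, so it divides the whole Smith form of the block. -/
theorem exists_unimodularEquiv_diagonal : ∀ {n : ℕ} (A : Matrix (Fin n) (Fin n) ℤ),
    ∃ s : Fin n → ℤ, (∀ i, 0 ≤ s i) ∧ (∀ i j, i ≤ j → s i ∣ s j) ∧
      UnimodularEquiv A (Matrix.diagonal s)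
  | 0, A => ⟨Fin.elim0, fun i => i.elim0, fun i => i.elim0, by
      convert UnimodularEquiv.refl A
      ext i
      exact i.elim0⟩
  | n + 1, A => by
    obtain ⟨B, hAB, h0, hdvd, hrow, hcol⟩ := exists_equiv_corner_block A
    obtain ⟨s, hs, hchain, hBs⟩ :=
      exists_unimodularEquiv_diagonal (B.submatrix Fin.succ Fin.succ)
    have hB : B = cornerBlock (B 0 0) (B.submatrix Fin.succ Fin.succ) := by
      ext i j
      refine Fin.cases ?_ (fun i => ?_) i <;> refine Fin.cases ?_ (fun j => ?_) j <;>
        simp [cornerBlock, hrow, hcol]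
    have hd (i : Fin n) : B 0 0 ∣ s i := by
      simpa using hBs.dvd (fun k l => hdvd k.succ l.succ) i i
    refine ⟨Fin.cons (B 0 0) s, ?_, ?_, hAB.trans ?_⟩
    · intro i
      refine Fin.cases ?_ (fun i => ?_) i
      · simpa using h0
      · simpa using hs i
    · intro i j hij
      induction i using Fin.cases with
      | zero =>
        induction j using Fin.cases with
        | zero => exact dvd_rfl
        | succ j => simpa using hd j
      | succ i =>
        induction j using Fin.cases with
        | zero => exact absurd hij (by simp)
        | succ j => simpa using hchain i j (by simpa using hij)
    · obtain ⟨P, Q, hP, hQ, h⟩ := hBs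
      refine ⟨_, _, isUnit_cornerBlock hP, isUnit_cornerBlock hQ, ?_⟩
      rw [← cornerBlock_diagonal, h]
      conv_rhs => rw [hB]
      simp [cornerBlock_mul]

theorem exists_isSmithForm (A : Matrix (Fin n) (Fin n) ℤ) : ∃ s, IsSmithForm A s := by
  obtain ⟨s, h0, hchain, h⟩ := exists_unimodularEquiv_diagonal A
  obtain ⟨P, Q, hP, hQ, h⟩ := h.symm
  exact ⟨s, h0, hchain, P, Q, (Matrix.isUnit_iff_isUnit_det _).1 hP,
    (Matrix.isUnit_iff_isUnit_det _).1 hQ, h⟩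

end SmithForm

/-! ### Valuations of the Smith form are determined modulo `p ^ m` -/

section Uniqueness

variable {n : ℕ}

/-- A square matrix over a commutative ring vanishing on a rectangle with side lengths `n - i` and
`i + 1` has determinant zero. -/
theorem det_eq_zero_of_zero_rectangle {R : Type*} [CommRing R] (Y : Matrix (Fin n) (Fin n) R)
    (i : Fin n) (h : ∀ a b, i ≤ a → b ≤ i → Y a b = 0) : Y.det = 0 := by
  rw [Matrix.det_apply]
  refine Finset.sum_eq_zero fun σ _ => ?_
  -- A permutation cannot send the `i + 1` indices up to `i` into the `i` indices below `i`.
  obtain ⟨b, hb, hσ⟩ : ∃ b ≤ i, i ≤ σ b := by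
    by_contra! hlt
    have := Finset.card_le_card_of_injOn (s := Finset.Iic i) (t := Finset.Iio i) σ
      (fun b hb => by simpa using hlt b (by simpa using hb)) σ.injective.injOn
    simp at this
  exact (congrArg (Equiv.Perm.sign σ • ·)
    (Finset.prod_eq_zero (f := fun x => Y (σ x) x)
      (Finset.mem_univ b) (h _ _ hσ hb))).trans (smul_zero _)

/-- If two divisibility chains give diagonal matrices that are equivalent modulo `p ^ m`, a power
of `p` up to `p ^ m` that divides an entry of one chain divides that of the other. -/
theorem pow_dvd_of_diagonal_mul_modEq {p m c : ℕ} (hp : p.Prime) {s t : Fin n → ℤ}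
    (hs : ∀ i j, i ≤ j → s i ∣ s j) (ht : ∀ i j, i ≤ j → t i ∣ t j)
    {X Y : Matrix (Fin n) (Fin n) ℤ} (hY : ¬ (p : ℤ) ∣ Y.det)
    (h : ∀ i j, (p : ℤ) ^ m ∣ t i * X i j - Y i j * s j) (hc : c ≤ m) (i : Fin n)
    (hi : (p : ℤ) ^ c ∣ t i) : (p : ℤ) ^ c ∣ s i := by
  by_contra hsi
  apply hY
  have hp' : Prime (p : ℤ) := Nat.prime_iff_prime_int.1 hp
  rw [← ZMod.intCast_zmod_eq_zero_iff_dvd _ p]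
  have hdet : ((Y.det : ℤ) : ZMod p) = (Y.map (Int.castRingHom (ZMod p))).det := by
    rw [← RingHom.mapMatrix_apply, ← RingHom.map_det]; rfl
  rw [hdet]
  -- For `i ≤ a` and `b ≤ i`, `p ^ c` divides `t a`, hence `Y a b * s b`. Were `Y a b` prime to `p`,
  -- `p ^ c` would divide `s b`, hence `s i`.
  refine det_eq_zero_of_zero_rectangle _ i fun a b ha hb => ?_
  rw [Matrix.map_apply, eq_intCast, ZMod.intCast_zmod_eq_zero_iff_dvd]
  by_contra hYab
  have h1 : (p : ℤ) ^ c ∣ Y a b * s b :=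
    (dvd_sub_right ((hi.trans (ht i a ha)).mul_right _)).1 ((pow_dvd_pow _ hc).trans (h a b))
  exact hsi (((IsCoprime.pow_left ((Prime.coprime_iff_not_dvd hp').2 hYab)).dvd_of_dvd_mul_left
    h1).trans (hs b i hb))

/-- The previous lemma is used in both directions: for the transposed relation with exponent `e i`,
then for the relation itself with exponent `e i + 1`, which is still at most `m`. -/
theorem emultiplicity_eq_of_diagonal_mul_modEq {p m : ℕ} (hp : p.Prime) {t : Fin n → ℤ}
    (ht : ∀ i j, i ≤ j → t i ∣ t j) {e : Fin n → ℕ} (he : Monotone e) (hem : ∀ i, e i < m)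
    {X Y : Matrix (Fin n) (Fin n) ℤ} (hX : ¬ (p : ℤ) ∣ X.det) (hY : ¬ (p : ℤ) ∣ Y.det)
    (h : ∀ i j, (p : ℤ) ^ m ∣ t i * X i j - Y i j * (p : ℤ) ^ e j) (i : Fin n) :
    emultiplicity (p : ℤ) (t i) = e i := by
  have hs : ∀ i j : Fin n, i ≤ j → (p : ℤ) ^ e i ∣ (p : ℤ) ^ e j :=
    fun i j hij => pow_dvd_pow _ (he hij)
  rw [emultiplicity_eq_coe]
  constructor
  · refine pow_dvd_of_diagonal_mul_modEq hp (s := t) (t := fun j => (p : ℤ) ^ e j) ht hs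
      (X := Y.transpose) (Y := X.transpose) (by rwa [Matrix.det_transpose]) (fun a b => ?_)
      (hem i).le i dvd_rfl
    rw [← dvd_neg]
    rw [show -((p : ℤ) ^ e a * Y.transpose a b - X.transpose a b * t b) =
      t b * X b a - Y b a * (p : ℤ) ^ e a by simp only [Matrix.transpose_apply]; ring]
    exact h b a
  · intro hdvd
    have := pow_dvd_of_diagonal_mul_modEq hp hs ht hY h (Nat.succ_le_of_lt (hem i)) i hdvd
    rw [pow_dvd_pow_iff (by exact_mod_cast hp.ne_zero)
      (Nat.prime_iff_prime_int.1 hp).not_isUnit] at this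
    omega

end Uniqueness

/-! ### Weighted sums of principal minors and Schwartz–Zippel -/

section MinorSum

variable {n : ℕ}

/-- The sum of the `k` first values of `e`. -/
def initialSum (e : Fin n → ℕ) (k : ℕ) : ℕ :=
  ∑ i ∈ Finset.univ.filter (fun i : Fin n => (i : ℕ) < k), e i

theorem card_filter_val_lt {k : ℕ} (hk : k ≤ n) :
    (Finset.univ.filter (fun i : Fin n => (i : ℕ) < k)).card = k := by
  rw [Fin.card_filter_val_lt]
  exact min_eq_right hk

/-- Exchange argument: `J \ I` and `I \ J` have equally many elements, and every index of the former
precedes every index of the latter. -/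
theorem initialSum_le_sum {e : Fin n → ℕ} (he : Monotone e) {k : ℕ} (hk : k ≤ n)
    {I : Finset (Fin n)} (hI : I.card = k) : initialSum e k ≤ ∑ i ∈ I, e i := by
  classical
  set J := Finset.univ.filter (fun i : Fin n => (i : ℕ) < k) with hJ
  have hcard : (J \ I).card = (I \ J).card :=
    (Finset.card_sdiff_comm (hI.trans (card_filter_val_lt hk).symm)).symm
  have hmin : ∑ i ∈ J \ I, e i ≤ ∑ i ∈ I \ J, e i := by
    calc ∑ i ∈ J \ I, e i ≤ (J \ I).card • J.sup e :=
          Finset.sum_le_card_nsmul _ _ _ fun i hi => Finset.le_sup (Finset.sdiff_subset hi)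
      _ = (I \ J).card • J.sup e := by rw [hcard]
      _ ≤ ∑ i ∈ I \ J, e i := Finset.card_nsmul_le_sum _ _ _ fun i hi =>
          Finset.sup_le fun j hj => he ?_
    simp only [hJ, Finset.mem_sdiff, Finset.mem_filter, Finset.mem_univ, true_and] at hi hj
    exact Fin.le_def.2 (by omega)
  have h1 := Finset.sum_inter_add_sum_sdiff J I e
  have h2 := Finset.sum_inter_add_sum_sdiff I J e
  rw [Finset.inter_comm] at h2
  change ∑ i ∈ J, e i ≤ _
  omega

/-- The sum of the principal `k`-minors of `W`, the minor with index set `I` being weighted by the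
power of `p` whose exponent is the excess of `∑ i ∈ I, e i` over its least possible value. -/
def weightedMinorSum {T : Type*} [CommRing T] (p : ℕ) (e : Fin n → ℕ) (k : ℕ)
    (W : Matrix (Fin n) (Fin n) T) : T :=
  ∑ I ∈ Finset.univ.powersetCard k, (p : T) ^ (∑ i ∈ I, e i - initialSum e k) *
    (W.submatrix (Subtype.val : I → Fin n) (Subtype.val : I → Fin n)).det

theorem map_weightedMinorSum {T T' : Type*} [CommRing T] [CommRing T'] (f : T →+* T') (p : ℕ)
    (e : Fin n → ℕ) (k : ℕ) (W : Matrix (Fin n) (Fin n) T) :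
    f (weightedMinorSum p e k W) = weightedMinorSum p e k (W.map f) := by
  simp only [weightedMinorSum, map_sum, map_mul, map_pow, map_natCast, RingHom.map_det]
  rfl

/-- The row factors come out of each principal minor as `p ^ ∑ i ∈ I, e i`, whose least exponent is
then factored out. -/
theorem charpoly_coeff_diagonal_mul {T : Type*} [CommRing T] (p : ℕ) {e : Fin n → ℕ}
    (he : Monotone e) {k : ℕ} (hk : k ≤ n) (W : Matrix (Fin n) (Fin n) T) :
    (Matrix.diagonal (fun i => (p : T) ^ e i) * W).charpoly.coeff (n - k) =
      (-1) ^ k * ((p : T) ^ initialSum e k * weightedMinorSum p e k W) := by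
  have h := Matrix.charpoly_coeff_eq_sum_minors
    (Matrix.diagonal (fun i => (p : T) ^ e i) * W) k (by simpa using hk)
  rw [Fintype.card_fin] at h
  rw [h]
  congr 1
  rw [weightedMinorSum, Finset.mul_sum]
  apply Finset.sum_congr rfl
  intro I hI
  have hsub : (Matrix.diagonal (fun i => (p : T) ^ e i) * W).submatrix
      (Subtype.val : I → Fin n) (Subtype.val : I → Fin n) =
      Matrix.diagonal (fun i : I => (p : T) ^ e i) * W.submatrix Subtype.val Subtype.val := by
    ext i j
    simp
  rw [hsub, Matrix.det_mul, Matrix.det_diagonal,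
    Finset.prod_coe_sort I (fun i => (p : T) ^ e i), Finset.prod_pow_eq_pow_sum, ← mul_assoc,
    ← pow_add, Nat.add_sub_cancel' (initialSum_le_sum he hk (Finset.mem_powersetCard.1 hI).2)]

theorem weightedMinorSum_top {T : Type*} [CommRing T] (p : ℕ) (e : Fin n → ℕ)
    (W : Matrix (Fin n) (Fin n) T) : weightedMinorSum p e n W = W.det := by
  have huniv : (Finset.univ : Finset (Fin n)).powersetCard n = {Finset.univ} := by
    simpa using Finset.powersetCard_self (Finset.univ : Finset (Fin n))
  have hE : initialSum e n = ∑ i, e i := by simp [initialSum]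
  rw [weightedMinorSum, huniv, Finset.sum_singleton, hE, Nat.sub_self, pow_zero, one_mul]
  convert Matrix.det_submatrix_equiv_self (Equiv.subtypeUnivEquiv (p := (· ∈ Finset.univ))
    fun i : Fin n => Finset.mem_univ i) W <;> rfl

/-- The diagonal projection on the first `k` coordinates has exactly one nonzero principal
`k`-minor. -/
theorem weightedMinorSum_diagonal {T : Type*} [CommRing T] (p : ℕ) (e : Fin n → ℕ) {k : ℕ}
    (hk : k ≤ n) : weightedMinorSum p e k
      (Matrix.diagonal fun i : Fin n => if (i : ℕ) < k then (1 : T) else 0) = 1 := by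
  have hsub (I : Finset (Fin n)) :
      (Matrix.diagonal fun i : Fin n => if (i : ℕ) < k then (1 : T) else 0).submatrix
      (Subtype.val : I → Fin n) (Subtype.val : I → Fin n) =
      Matrix.diagonal fun i : I => if ((i : Fin n) : ℕ) < k then (1 : T) else 0 :=
    Matrix.submatrix_diagonal _ _ Subtype.val_injective
  rw [weightedMinorSum, Finset.sum_eq_single (Finset.univ.filter (fun i : Fin n => (i : ℕ) < k))]
  · rw [hsub, Matrix.det_diagonal, Finset.prod_eq_one, initialSum, Nat.sub_self, pow_zero, one_mul]
    rintro ⟨i, hi⟩ -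
    exact if_pos (Finset.mem_filter.1 hi).2
  · intro I hI hne
    obtain ⟨i, hi, hik⟩ : ∃ i ∈ I, ¬ (i : ℕ) < k := by
      by_contra! h
      refine hne (Finset.eq_of_subset_of_card_le (fun i hi => by simpa using h i hi) ?_)
      rw [(Finset.mem_powersetCard.1 hI).2, card_filter_val_lt hk]
    rw [hsub, Matrix.det_diagonal, Finset.prod_eq_zero (Finset.mem_univ ⟨i, hi⟩) (if_neg hik),
      mul_zero]
  · intro h
    exact absurd (Finset.mem_powersetCard.2 ⟨Finset.subset_univ _, card_filter_val_lt hk⟩) h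

theorem totalDegree_det_le {σ ι F : Type*} [CommRing F] [Fintype ι] [DecidableEq ι]
    (M : Matrix ι ι (MvPolynomial σ F)) (h : ∀ i j, (M i j).totalDegree ≤ 1) :
    M.det.totalDegree ≤ Fintype.card ι := by
  rw [Matrix.det_apply']
  refine MvPolynomial.totalDegree_finsetSum_le fun τ _ => ?_
  refine (MvPolynomial.totalDegree_mul _ _).trans ?_
  rw [← map_intCast (MvPolynomial.C : F →+* MvPolynomial σ F), MvPolynomial.totalDegree_C,
    zero_add]
  refine (MvPolynomial.totalDegree_finsetProd _ _).trans ?_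
  refine (Finset.sum_le_sum fun i _ => h (τ i) i).trans ?_
  simp

theorem totalDegree_weightedMinorSum_le {F : Type*} [CommRing F] [Nontrivial F] (p : ℕ) (e : Fin n → ℕ)
    (k : ℕ) : (weightedMinorSum p e k
      (Matrix.mvPolynomialX (Fin n) (Fin n) F)).totalDegree ≤ k := by
  refine MvPolynomial.totalDegree_finsetSum_le fun I hI => ?_
  refine (MvPolynomial.totalDegree_mul _ _).trans ?_
  rw [← map_natCast (MvPolynomial.C : F →+* MvPolynomial (Fin n × Fin n) F), ← map_pow,
    MvPolynomial.totalDegree_C, zero_add]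
  refine (totalDegree_det_le _ fun i j => ?_).trans ?_
  · simp
  · rw [Fintype.card_coe, (Finset.mem_powersetCard.1 hI).2]

/-- The Schwartz–Zippel bound over a finite field, for an arbitrary finite set of variables. -/
theorem card_zeros_mul_card_le {σ F : Type*} [Fintype σ] [DecidableEq σ] [Field F] [Fintype F]
    [DecidableEq F] {g : MvPolynomial σ F} (hg : g ≠ 0) :
    (Finset.univ.filter fun x : σ → F => MvPolynomial.eval x g = 0).card * Fintype.card F ≤
      g.totalDegree * Fintype.card (σ → F) := by
  let ρ := Fintype.equivFin σ
  have hg' : MvPolynomial.rename ρ g ≠ 0 := by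
    rw [Ne, map_eq_zero_iff _ (MvPolynomial.rename_injective _ ρ.injective)]
    exact hg
  have h := MvPolynomial.schwartz_zippel_totalDegree hg' (Finset.univ : Finset F)
  have hcard : (Finset.univ.filter fun x : σ → F => MvPolynomial.eval x g = 0).card =
      (Finset.filter (fun f => MvPolynomial.eval f (MvPolynomial.rename ρ g) = 0)
        (Fintype.piFinset fun _ => (Finset.univ : Finset F))).card := by
    refine Finset.card_equiv (ρ.arrowCongr (Equiv.refl F)) fun x => ?_
    simp [MvPolynomial.eval_rename, Function.comp_def]
  have hF : (0 : ℚ≥0) < Fintype.card F := by exact_mod_cast Fintype.card_pos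
  rw [← hcard, Finset.card_univ, div_le_div_iff₀ (pow_pos hF _) hF] at h
  rw [Fintype.card_fun]
  have h' := h.trans (mul_le_mul_of_nonneg_right
    (Nat.cast_le.2 (MvPolynomial.totalDegree_rename_le ρ g)) (by positivity))
  exact_mod_cast h'

theorem card_weightedMinorSum_eq_zero_le (p : ℕ) [Fact p.Prime] (e : Fin n → ℕ) {k : ℕ}
    (hk : k ≤ n) :
    (Finset.univ.filter fun W : Matrix (Fin n) (Fin n) (ZMod p) =>
      weightedMinorSum p e k W = 0).card * p ≤
      k * Fintype.card (Matrix (Fin n) (Fin n) (ZMod p)) := by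
  have heval (W : Matrix (Fin n) (Fin n) (ZMod p)) :
      MvPolynomial.eval (fun q : Fin n × Fin n => W q.1 q.2)
        (weightedMinorSum p e k (Matrix.mvPolynomialX (Fin n) (Fin n) (ZMod p))) =
      weightedMinorSum p e k W := by
    rw [map_weightedMinorSum]
    congr 1
    exact Matrix.mvPolynomialX_mapMatrix_eval W
  -- The projection on the first `k` coordinates is a point where the polynomial takes the value
  -- `1`.
  have hne : weightedMinorSum p e k (Matrix.mvPolynomialX (Fin n) (Fin n) (ZMod p)) ≠ 0 := by
    intro h0
    have := heval (Matrix.diagonal fun i : Fin n => if (i : ℕ) < k then (1 : ZMod p) else 0)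
    rw [h0, map_zero, weightedMinorSum_diagonal p e hk] at this
    exact zero_ne_one this
  have hcard := card_zeros_mul_card_le hne
  rw [ZMod.card] at hcard
  have h1 : (Finset.univ.filter fun W : Matrix (Fin n) (Fin n) (ZMod p) =>
      weightedMinorSum p e k W = 0).card = (Finset.univ.filter fun x : Fin n × Fin n → ZMod p =>
        MvPolynomial.eval x
          (weightedMinorSum p e k (Matrix.mvPolynomialX (Fin n) (Fin n) (ZMod p))) = 0).card := by
    refine Finset.card_equiv (Equiv.curry (Fin n) (Fin n) (ZMod p)).symm fun W => ?_
    simp only [Finset.mem_filter, Finset.mem_univ, true_and]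
    rw [← heval W]
    rfl
  have h2 : Fintype.card (Matrix (Fin n) (Fin n) (ZMod p)) =
      Fintype.card (Fin n × Fin n → ZMod p) :=
    Fintype.card_congr (Equiv.curry (Fin n) (Fin n) (ZMod p)).symm
  rw [h1, h2]
  exact hcard.trans (Nat.mul_le_mul_right _ (totalDegree_weightedMinorSum_le p e k))

end MinorSum

/-! ### Newton polygons through Gauss norms -/

section NewtonPolygon

open Polynomial

theorem gaussNorm_X_sub_C {K : Type*} [Field K] (v : AbsoluteValue K ℝ) {c : ℝ} (hc : 0 < c)
    (a : K) : (X - C a).gaussNorm v c = max c (v a) := by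
  have h0 : (X - C a).coeff 0 = -a := by simp
  have h1 : (X - C a).coeff 1 = 1 := by simp
  apply le_antisymm
  · obtain ⟨i, hi⟩ := (X - C a).exists_eq_gaussNorm v c
    rw [hi]
    match i with
    | 0 => simp
    | 1 => simp [h1]
    | i + 2 =>
      have h2 : (X - C a).coeff (i + 2) = 0 := by simp [coeff_X]
      simp [h2, hc.le]
  · have h0' := (X - C a).le_gaussNorm v hc.le 0
    have h1' := (X - C a).le_gaussNorm v hc.le 1
    rw [h0] at h0'
    rw [h1] at h1'
    simp only [map_one, one_mul, pow_one, pow_zero, mul_one, AbsoluteValue.map_neg] at h0' h1'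
    exact max_le h1' h0'

theorem gaussNorm_prod_X_sub_C {K ι : Type*} [Field K] (v : AbsoluteValue K ℝ)
    (hv : IsNonarchimedean v) {c : ℝ} (hc : 0 < c) (s : Finset ι) (a : ι → K) :
    (∏ i ∈ s, (X - C (a i))).gaussNorm v c = ∏ i ∈ s, max c (v (a i)) := by
  classical
  induction s using Finset.induction_on with
  | empty => simpa using gaussNorm_C v c (1 : K)
  | insert i s hi ih =>
    rw [Finset.prod_insert hi, Finset.prod_insert hi, gaussNorm_mul hv hc, ih,
      gaussNorm_X_sub_C v hc]

/-- If the coefficients of a polynomial have the absolute values of the products of initial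
segments of an antitone sequence `b`, its Gauss norms are those of a product of linear factors
whose roots have the absolute values `b i`. -/
theorem gaussNorm_eq_prod_max {K : Type*} [Field K] (v : AbsoluteValue K ℝ) {n : ℕ} {f : K[X]}
    (hdeg : f.natDegree ≤ n) {b : Fin n → ℝ} (hb : Antitone b) (hb0 : ∀ i, 0 < b i)
    (hf : ∀ k ≤ n, v (f.coeff (n - k)) = ∏ i : Fin n, if (i : ℕ) < k then b i else 1)
    {c : ℝ} (hc : 0 < c) : f.gaussNorm v c = ∏ i, max c (b i) := by
  have hterm : ∀ k ≤ n, v (f.coeff (n - k)) * c ^ (n - k) =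
      ∏ i : Fin n, if (i : ℕ) < k then b i else c := by
    intro k hk
    have hcpow : c ^ (n - k) = ∏ i : Fin n, if (i : ℕ) < k then 1 else c := by
      rw [Finset.prod_ite, Finset.prod_const_one, one_mul, Finset.prod_const]
      congr 1
      have h := Finset.card_filter_add_card_filter_not (s := (Finset.univ : Finset (Fin n)))
        (fun i : Fin n => (i : ℕ) < k)
      rw [card_filter_val_lt hk, Finset.card_univ, Fintype.card_fin] at h
      omega
    rw [hf k hk, hcpow, ← Finset.prod_mul_distrib]
    refine Finset.prod_congr rfl fun i _ => ?_
    split_ifs <;> simp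
  apply le_antisymm
  · obtain ⟨i, hi⟩ := f.exists_eq_gaussNorm v c
    rw [hi]
    by_cases hin : i ≤ n
    · have := hterm (n - i) (Nat.sub_le _ _)
      rw [Nat.sub_sub_self hin] at this
      rw [this]
      refine Finset.prod_le_prod (fun j _ => ?_) fun j _ => ?_
      · split_ifs
        exacts [(hb0 j).le, hc.le]
      · split_ifs
        exacts [le_max_right _ _, le_max_left _ _]
    · rw [coeff_eq_zero_of_natDegree_lt (by omega), map_zero, zero_mul]
      exact Finset.prod_nonneg fun j _ => hc.le.trans (le_max_left _ _)
  -- With `k` the number of indices for which `b i` exceeds `c`, the term of degree `n - k` attains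
  -- the product of the maxima.
  · obtain ⟨k, hk, hkb⟩ : ∃ k ≤ n, ∀ i : Fin n, ((i : ℕ) < k → c ≤ b i) ∧
        (¬ (i : ℕ) < k → b i ≤ c) := by
      by_cases h : ∃ k, ∃ h : k < n, b ⟨k, h⟩ ≤ c
      · classical
        obtain ⟨hlt, hle⟩ := Nat.find_spec h
        refine ⟨Nat.find h, hlt.le, fun i => ⟨fun hi => ?_, fun hi => ?_⟩⟩
        · have := Nat.find_min h hi
          push Not at this
          exact (this i.2).le
        · exact (hb (Fin.le_def.2 (not_lt.1 hi))).trans hle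
      · push Not at h
        exact ⟨n, le_rfl, fun i => ⟨fun _ => (h i i.2).le, fun hi => absurd i.2 hi⟩⟩
    have := f.le_gaussNorm v hc.le (n - k)
    rw [hterm k hk] at this
    refine le_of_eq_of_le (Finset.prod_congr rfl fun i _ => ?_) this
    split_ifs with hi
    · exact max_eq_right ((hkb i).1 hi)
    · exact max_eq_left ((hkb i).2 hi)

/-- Take `c = b i`. The factors before `i` agree; from `i` on, those of `b` have the least possible
value `c`, while `a i` would exceed it. -/
theorem not_lt_of_prod_max_eq {n : ℕ} {a b : Fin n → ℝ} (hb : Antitone b)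
    (hb0 : ∀ i, 0 < b i) (h : ∀ c, 0 < c → ∏ i, max c (a i) = ∏ i, max c (b i)) (i : Fin n)
    (hlt : ∀ j < i, a j = b j) : ¬ b i < a i := by
  intro hi
  refine (h (b i) (hb0 i)).not_gt (Finset.prod_lt_prod (fun j _ => lt_max_of_lt_left (hb0 i))
    (fun j _ => ?_) ⟨i, Finset.mem_univ i, ?_⟩)
  · rcases lt_or_ge j i with hj | hj
    · rw [hlt j hj]
    · rw [max_eq_left (hb hj)]
      exact le_max_left _ _
  · rw [max_self]
    exact lt_max_of_lt_right hi

/-- An antitone sequence is determined by the products of its truncations from below. -/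
theorem eq_of_prod_max_eq {n : ℕ} {a b : Fin n → ℝ} (ha : Antitone a) (hb : Antitone b)
    (ha0 : ∀ i, 0 < a i) (hb0 : ∀ i, 0 < b i)
    (h : ∀ c, 0 < c → ∏ i, max c (a i) = ∏ i, max c (b i)) (i : Fin n) : a i = b i := by
  induction i using WellFoundedLT.induction with
  | ind i ih =>
    exact le_antisymm (not_lt.1 (not_lt_of_prod_max_eq hb hb0 h i ih))
      (not_lt.1 (not_lt_of_prod_max_eq ha ha0 (fun c hc => (h c hc).symm) i
        fun j hj => (ih j hj).symm))

end NewtonPolygon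

/-! ### Valuations of the roots in the algebraic closure of `ℚ_p` -/

section Eigenvalues

open Polynomial

variable {p : ℕ} [Fact p.Prime]

/-- The norm is the spectral norm, which is given by the constant coefficient of the minimal
polynomial. -/
theorem norm_eq_rpow_neg_padicOrd {x : PadicAlgCl p} (hx : x ≠ 0) :
    ‖x‖ = (p : ℝ) ^ (-(padicOrd p x : ℝ)) := by
  have hint : IsIntegral ℚ_[p] x := Algebra.IsIntegral.isIntegral x
  have hp0 : (0 : ℝ) ≤ p := Nat.cast_nonneg p
  rw [← PadicAlgCl.spectralNorm_eq, spectralNorm.spectralNorm_eq_norm_coeff_zero_rpow,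
    Padic.norm_eq_zpow_neg_valuation (minpoly.coeff_zero_ne_zero hint hx), ← Real.rpow_intCast,
    ← Real.rpow_mul hp0, padicOrd]
  congr 1
  push_cast
  ring

theorem norm_intCast_eq_of_emultiplicity {z : ℤ} {c : ℕ}
    (h : emultiplicity (p : ℤ) z = c) : ‖(z : PadicAlgCl p)‖ = ((p : ℝ)⁻¹) ^ c := by
  obtain ⟨⟨u, rfl⟩, hnd⟩ := emultiplicity_eq_coe.1 h
  have hu : ¬ (p : ℤ) ∣ u := fun ⟨w, hw⟩ => hnd ⟨w, by rw [hw]; ring⟩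
  have hcast : ((((p : ℤ) ^ c * u : ℤ) : ℚ_[p]) : PadicAlgCl p) =
      (((p : ℤ) ^ c * u : ℤ) : PadicAlgCl p) := map_intCast (algebraMap ℚ_[p] (PadicAlgCl p)) _
  rw [← hcast, PadicAlgCl.norm_extends]
  have hu1 : ‖(u : ℚ_[p])‖ = 1 :=
    le_antisymm (Padic.norm_int_le_one u)
      (not_lt.1 fun hlt => hu ((Padic.norm_intCast_lt_one_iff (k := u)).1 hlt))
  push_cast
  rw [norm_mul, hu1, mul_one, norm_pow, Padic.norm_p]

/-- A monic integer polynomial whose coefficients have valuations `e₁ + ⋯ + e_k`, with `e`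
monotone, has roots of valuations `e₁, …, eₙ`. -/
theorem exists_roots_padicOrd_eq {n : ℕ} {f : ℤ[X]} (hf : f.Monic) (hdeg : f.natDegree = n)
    {e : Fin n → ℕ} (he : Monotone e)
    (h : ∀ k, 1 ≤ k → k ≤ n → emultiplicity (p : ℤ) (f.coeff (n - k)) = initialSum e k) :
    ∃ lam : Fin n → AlgebraicClosure ℚ_[p],
      Multiset.map lam Finset.univ.val = f.aroots (AlgebraicClosure ℚ_[p]) ∧
      (∀ i, lam i ≠ 0) ∧
      (∀ i j, i ≤ j → padicOrd p (lam i) ≤ padicOrd p (lam j)) ∧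
      ∀ i, (e i : ℚ) = padicOrd p (lam i) := by
  have hp1 : (1 : ℝ) < p := by exact_mod_cast (Fact.out : p.Prime).one_lt
  have hp0 : (0 : ℝ) < p := one_pos.trans hp1
  set g : (PadicAlgCl p)[X] := f.map (algebraMap ℤ (PadicAlgCl p)) with hg
  have hgmonic : g.Monic := hf.map _
  have hgdeg : g.natDegree = n := by rw [hg, hf.natDegree_map, hdeg]
  have hsplit : g.Splits := IsAlgClosed.splits g
  have hcard : Multiset.card g.roots = n := by
    rw [← hgdeg]
    exact (splits_iff_card_roots.1 hsplit)
  obtain ⟨lam₀, hlam₀⟩ : ∃ lam : Fin n → PadicAlgCl p,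
      Multiset.map lam Finset.univ.val = g.roots := by
    obtain ⟨l, hl⟩ := Quot.exists_rep g.roots
    have hlen : l.length = n := by rw [← hcard, ← hl]; rfl
    subst hlen
    refine ⟨l.get, ?_⟩
    rw [← hl]
    simp
  let σ := Tuple.sort fun i => padicOrd p (lam₀ i)
  set lam := lam₀ ∘ σ with hlamdef
  have hmono : Monotone fun i => padicOrd p (lam i) :=
    Tuple.monotone_sort fun i => padicOrd p (lam₀ i)
  have hlam : Multiset.map lam Finset.univ.val = g.roots := by
    rw [← hlam₀, hlamdef, ← Multiset.map_map]
    congr 1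
    exact congrArg Finset.val (Finset.map_univ_equiv σ)
  have hprod : g = ∏ i, (X - C (lam i)) := by
    rw [hsplit.eq_prod_roots_of_monic hgmonic, ← hlam, Multiset.map_map]
    rfl
  have hcoeff : ∀ k ≤ n, ‖g.coeff (n - k)‖ =
      ∏ i : Fin n, if (i : ℕ) < k then ((p : ℝ)⁻¹) ^ e i else 1 := by
    intro k hk
    have hgc : g.coeff (n - k) = (f.coeff (n - k) : PadicAlgCl p) := by
      rw [hg, coeff_map, eq_intCast]
    rw [← Finset.prod_filter, Finset.prod_pow_eq_pow_sum, hgc]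
    rcases Nat.eq_zero_or_pos k with rfl | hk0
    · have : f.coeff n = 1 := by rw [← hdeg]; exact hf
      simp [this]
    · exact norm_intCast_eq_of_emultiplicity (h k hk0 hk)
  have hne (i : Fin n) : lam i ≠ 0 := by
    intro h0
    have h1 : g.coeff (n - n) = 0 := by
      rw [Nat.sub_self, coeff_zero_eq_eval_zero, hprod, eval_prod]
      exact Finset.prod_eq_zero (Finset.mem_univ i) (by simp [h0])
    have h2 := hcoeff n le_rfl
    rw [h1, norm_zero] at h2
    refine (Finset.prod_pos fun i _ => ?_).ne h2
    split_ifs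
    · positivity
    · exact one_pos
  have hnorm (i : Fin n) : ‖lam i‖ = (p : ℝ) ^ (-(padicOrd p (lam i) : ℝ)) :=
    norm_eq_rpow_neg_padicOrd (hne i)
  let v : AbsoluteValue (PadicAlgCl p) ℝ := NormedField.toAbsoluteValue _
  have hv : ∀ x, v x = ‖x‖ := fun _ => rfl
  have hanti : Antitone fun i => ((p : ℝ)⁻¹) ^ e i := fun i j hij =>
    pow_le_pow_of_le_one (by positivity) (inv_le_one_of_one_le₀ hp1.le) (he hij)
  have heq := eq_of_prod_max_eq (a := fun i => ‖lam i‖) (b := fun i => ((p : ℝ)⁻¹) ^ e i)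
    (fun i j hij => by
      simp only [hnorm]
      exact Real.rpow_le_rpow_of_exponent_le hp1.le
        (neg_le_neg (by exact_mod_cast hmono hij)))
    hanti (fun i => norm_pos_iff.2 (hne i)) (fun i => by positivity)
    (fun c hc => by
      rw [← gaussNorm_eq_prod_max v hgdeg.le hanti (fun i => by positivity) hcoeff hc, hprod,
        gaussNorm_prod_X_sub_C v (PadicAlgCl.isNonarchimedean p) hc]
      rfl)
  refine ⟨lam, hlam, hne, fun i j hij => hmono hij, fun i => ?_⟩
  have hi := heq i
  simp only [hnorm] at hi
  rw [inv_pow, ← Real.rpow_natCast, ← Real.rpow_neg hp0.le,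
    Real.rpow_right_inj hp0 hp1.ne'] at hi
  have : (padicOrd p (lam i) : ℝ) = ((e i : ℚ) : ℝ) := by push_cast; linarith
  exact_mod_cast this.symm

end Eigenvalues

/-! ### Characterized nonsingular matrices are correspondent -/

section Correspondence

variable {n : ℕ}

theorem IsSmithForm.ne_zero {A : Matrix (Fin n) (Fin n) ℤ} {s : Fin n → ℤ} (h : IsSmithForm A s)
    (hA : A.det ≠ 0) (i : Fin n) : s i ≠ 0 := by
  obtain ⟨-, -, U, V, -, -, rfl⟩ := h
  rw [Matrix.det_mul, Matrix.det_mul, Matrix.det_diagonal] at hA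
  intro hi
  exact hA (by rw [Finset.prod_eq_zero (Finset.mem_univ i) hi]; simp)

theorem IsSmithForm.det_ne_zero {A : Matrix (Fin n) (Fin n) ℤ} {s : Fin n → ℤ}
    (h : IsSmithForm A s) (hs : ∀ i, s i ≠ 0) : A.det ≠ 0 := by
  obtain ⟨-, -, U, V, hU, hV, rfl⟩ := h
  rw [Matrix.det_mul, Matrix.det_mul, Matrix.det_diagonal]
  exact mul_ne_zero (mul_ne_zero hU.ne_zero (Finset.prod_ne_zero_iff.2 fun i _ => hs i)) hV.ne_zero

theorem emultiplicity_prod_initial {p : ℕ} (hp : p.Prime) {s : Fin n → ℤ} {e : Fin n → ℕ}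
    (h : ∀ i, emultiplicity (p : ℤ) (s i) = e i) (k : ℕ) :
    emultiplicity (p : ℤ) (∏ i ∈ Finset.univ.filter (fun i : Fin n => (i : ℕ) < k), s i) =
      initialSum e k := by
  rw [Finset.emultiplicity_prod (Nat.prime_iff_prime_int.1 hp), initialSum]
  simp [h]

theorem IsPCharacterized.isPCorrespondent {p : ℕ} [Fact p.Prime] {A : Matrix (Fin n) (Fin n) ℤ}
    (h : IsPCharacterized p A) (hA : A.det ≠ 0) : IsPCorrespondent p A := by
  classical
  have hp : p.Prime := Fact.out
  obtain ⟨s, hs, hchar⟩ := h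
  have hs0 := hs.ne_zero hA
  have hrank : A.rank = n := by simpa using Matrix.rank_of_det_ne_zero hA
  have hem (i : Fin n) : emultiplicity (p : ℤ) (s i) = (padicValInt p (s i) : ℕ∞) := by
    rw [padicValInt.of_ne_one_ne_zero hp.ne_one (hs0 i)]
    exact (Int.finiteMultiplicity_iff.2
      ⟨by simpa using hp.ne_one, hs0 i⟩).emultiplicity_eq_multiplicity
  have hmono : Monotone fun i => padicValInt p (s i) := fun i j hij => by
    have h1 : emultiplicity (p : ℤ) (s i) ≤ emultiplicity (p : ℤ) (s j) :=
      emultiplicity_le_emultiplicity_of_dvd_right (hs.2.1 i j hij)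
    rw [hem, hem] at h1
    exact_mod_cast h1
  obtain ⟨lam, hroots, hne, hsort, hval⟩ := exists_roots_padicOrd_eq (p := p)
    A.charpoly_monic (by simp) hmono
    (fun k hk hkn => (hchar k hk (by omega)).trans (emultiplicity_prod_initial hp hem k))
  have hfilter : (A.charpoly.aroots (AlgebraicClosure ℚ_[p])).filter (fun x => x ≠ 0) =
      A.charpoly.aroots (AlgebraicClosure ℚ_[p]) := by
    rw [Multiset.filter_eq_self, ← hroots]
    intro x hx
    obtain ⟨i, -, rfl⟩ := Multiset.mem_map.1 hx
    exact hne i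
  -- The rank occurs in the type of `lam`; a free `r` allows substitution of `r = n`.
  have key : ∀ (r : ℕ) (hr : r ≤ n), r = n → ∃ lam : Fin r → AlgebraicClosure ℚ_[p],
      Multiset.map lam Finset.univ.val =
        (A.charpoly.aroots (AlgebraicClosure ℚ_[p])).filter (fun x => x ≠ 0) ∧
      (∀ i j, i ≤ j → padicOrd p (lam i) ≤ padicOrd p (lam j)) ∧
      ∀ i : Fin r, (padicValInt p (s (Fin.castLE hr i)) : ℚ) = padicOrd p (lam i) := by
    rintro r hr rfl
    exact ⟨lam, hroots.trans hfilter.symm, hsort, hval⟩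
  refine ⟨s, hs, ?_⟩
  convert key A.rank A.rank_le_width hrank

end Correspondence

/-! ### Counting on orbits and fibres -/

section Counting

open Finset

/-- The orbit of `S` under multiplication by units on both sides. -/
noncomputable def unitOrbit {M : Type*} [Monoid M] [Fintype M] (S : M) : Finset M := by
  classical exact univ.image fun g : Mˣ × Mˣ => (g.1 : M) * S * g.2

theorem mem_unitOrbit {M : Type*} [Monoid M] [Fintype M] {S B : M} :
    B ∈ unitOrbit S ↔ ∃ u v : Mˣ, (u : M) * S * v = B := by
  classical simp [unitOrbit]

open Classical in
-- Orbit–stabilizer: each fibre of `(u, v) ↦ u S v` is a translate of the stabilizer of `S`.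
theorem card_filter_units_pairs {M : Type*} [Monoid M] [Fintype M] [Fintype Mˣ] (S : M) (Q : M → Prop) :
    #{g : Mˣ × Mˣ | Q ((g.1 : M) * S * g.2)} =
      #{B ∈ unitOrbit S | Q B} * #{g : Mˣ × Mˣ | (g.1 : M) * S * g.2 = S} := by
  rw [Finset.card_eq_sum_card_fiberwise (f := fun g : Mˣ × Mˣ => (g.1 : M) * S * g.2)
    (t := {B ∈ unitOrbit S | Q B})]
  · rw [← smul_eq_mul, ← Finset.sum_const]
    refine Finset.sum_congr rfl fun B hB => ?_
    obtain ⟨hB, hQ⟩ := Finset.mem_filter.1 hB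
    obtain ⟨u, v, rfl⟩ := mem_unitOrbit.1 hB
    refine Finset.card_equiv ((Equiv.mulLeft u⁻¹).prodCongr (Equiv.mulRight v⁻¹)) fun g => ?_
    simp only [mem_filter, mem_univ, true_and, Equiv.prodCongr_apply, Prod.map_fst, Prod.map_snd,
      Equiv.coe_mulLeft, Equiv.coe_mulRight, Units.val_mul]
    have hiff : ((u⁻¹ : Mˣ) : M) * g.1 * S * (g.2 * (v⁻¹ : Mˣ)) = S ↔
        (g.1 : M) * S * g.2 = u * S * v := by
      simp only [← mul_assoc]
      rw [Units.mul_inv_eq_iff_eq_mul]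
      simp only [mul_assoc]
      rw [Units.inv_mul_eq_iff_eq_mul]
    rw [hiff]
    constructor
    · exact fun h => h.2
    · exact fun h => ⟨by rw [h]; exact hQ, h⟩
  · intro g hg
    simp only [coe_filter, mem_univ, true_and, Set.mem_ofPred_eq] at hg ⊢
    exact ⟨mem_unitOrbit.2 ⟨g.1, g.2, rfl⟩, hg⟩

open Classical in
/-- A property that holds for `u S v` whenever `v u` lies in a given set of units is at least as
frequent on the orbit of `S` as that set is among the units. -/
theorem mul_card_unitOrbit_le {M : Type*} [Monoid M] [Fintype M] [Fintype Mˣ] (S : M)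
    {P Q : M → Prop} (hPQ : ∀ u v : Mˣ, P (v * u) → Q (u * S * v)) {δ : ℝ}
    (h : δ * (Fintype.card Mˣ : ℝ) ≤ (#{w : Mˣ | P w} : ℝ)) :
    δ * (#(unitOrbit S) : ℝ) ≤ (#{B ∈ unitOrbit S | Q B} : ℝ) := by
  set c := #{g : Mˣ × Mˣ | (g.1 : M) * S * g.2 = S} with hc
  have hc0 : 0 < c := Finset.card_pos.2 ⟨1, by simp⟩
  have hall : Fintype.card Mˣ * Fintype.card Mˣ = #(unitOrbit S) * c := by
    have := card_filter_units_pairs S fun _ => True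
    simpa using this
  -- The map `(u, v) ↦ (v u, u)` is a bijection on pairs, so `v u` is equidistributed.
  have hP : #{w : Mˣ | P w} * Fintype.card Mˣ = #{g : Mˣ × Mˣ | P (g.2 * g.1)} := by
    rw [← Finset.card_univ, ← Finset.card_product]
    refine Finset.card_bij' (fun x _ => (x.2, x.1 * x.2⁻¹)) (fun g _ => (g.2 * g.1, g.1))
      ?_ ?_ ?_ ?_
    · rintro ⟨w, u⟩ hw
      simpa using hw
    · rintro ⟨u, v⟩ hu
      simpa using hu
    · rintro ⟨w, u⟩ -
      simp
    · rintro ⟨u, v⟩ -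
      simp
  have hle : #{w : Mˣ | P w} * Fintype.card Mˣ ≤ #{B ∈ unitOrbit S | Q B} * c := by
    rw [hP, ← card_filter_units_pairs]
    exact Finset.card_le_card fun g hg => by
      simp only [mem_filter, mem_univ, true_and] at hg ⊢
      exact hPQ _ _ hg
  have hcR : (0 : ℝ) < c := by exact_mod_cast hc0
  refine le_of_mul_le_mul_right ?_ hcR
  calc δ * (#(unitOrbit S) : ℝ) * c
      = δ * (Fintype.card Mˣ : ℝ) * Fintype.card Mˣ := by
        rw [mul_assoc, mul_assoc]
        congr 1
        exact_mod_cast hall.symm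
    _ ≤ (#{w : Mˣ | P w} : ℝ) * Fintype.card Mˣ := by gcongr
    _ ≤ (#{B ∈ unitOrbit S | Q B} : ℝ) * c := by exact_mod_cast hle

open Classical in
/-- The fibres of a surjective homomorphism of finite groups have the same size. -/
theorem card_filter_comp_mul_card {G H : Type*} [AddGroup G] [AddGroup H] [Fintype G] [Fintype H]
    (f : G →+ H) (hf : Function.Surjective f) (P : H → Prop) :
    #{g | P (f g)} * Fintype.card H = #{h | P h} * Fintype.card G := by
  have hfib : ∀ h : H, #{g | f g = h} = #{g | f g = 0} := fun h =>
    AddMonoidHom.card_fiber_eq_of_mem_range f (hf h) (hf 0)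
  have hcount : ∀ P : H → Prop, #{g | P (f g)} = #{h | P h} * #{g | f g = 0} := by
    intro P
    rw [Finset.card_eq_sum_card_fiberwise (f := f) (t := {h | P h}) (fun g hg => by simpa using hg),
      ← smul_eq_mul, ← Finset.sum_const]
    refine Finset.sum_congr rfl fun h hh => ?_
    rw [← hfib h]
    congr 1
    ext g
    simp only [mem_filter, mem_univ, true_and] at hh ⊢
    exact ⟨fun h => h.2, fun h => ⟨by rwa [h], h⟩⟩
  have hall := hcount fun _ => True
  simp only [filter_true, Finset.card_univ] at hall
  rw [hcount P, hall]
  ring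

end Counting

/-! ### The Smith class as an orbit modulo `p ^ m` -/

section Residues

open Finset

variable {n p m : ℕ}

/-- The representative with entries in `[0, N)` of a matrix of residues modulo `N`. -/
def residueLift {N : ℕ} (B : Matrix (Fin n) (Fin n) (ZMod N)) : Matrix (Fin n) (Fin n) ℤ :=
  B.map fun x => (x.val : ℤ)

theorem residueLift_map {N : ℕ} [NeZero N] (B : Matrix (Fin n) (Fin n) (ZMod N)) :
    (residueLift B).map (Int.castRingHom (ZMod N)) = B := by
  ext i j
  simp [residueLift]

theorem residueLift_of_map {N : ℕ} [NeZero N] {A : Matrix (Fin n) (Fin n) ℤ}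
    (hA : ∀ i j, 0 ≤ A i j ∧ A i j < N) :
    residueLift (A.map (Int.castRingHom (ZMod N))) = A := by
  ext i j
  have h := ZMod.val_intCast (n := N) (A i j)
  rwa [Int.emod_eq_of_lt (hA i j).1 (hA i j).2] at h

theorem residueLift_injective {N : ℕ} [NeZero N] :
    Function.Injective (residueLift : Matrix (Fin n) (Fin n) (ZMod N) → _) := fun B C h => by
  rw [← residueLift_map B, h, residueLift_map]

theorem not_dvd_det_of_isUnit_map (hp : p.Prime) (hm : m ≠ 0) {X : Matrix (Fin n) (Fin n) ℤ}
    (hX : IsUnit (X.map (Int.castRingHom (ZMod (p ^ m))))) : ¬ (p : ℤ) ∣ X.det := by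
  rw [Matrix.isUnit_iff_isUnit_det, ← RingHom.mapMatrix_apply, ← RingHom.map_det,
    eq_intCast, ZMod.coe_int_isUnit_iff_isCoprime] at hX
  intro h
  have h1 : IsCoprime (p : ℤ) X.det := by
    push_cast at hX
    exact (IsCoprime.pow_left_iff (Nat.pos_of_ne_zero hm)).1 hX
  exact (Nat.prime_iff_prime_int.1 hp).not_isUnit (h1.isUnit_of_dvd' dvd_rfl h)

/-- The matrices modulo `p ^ m` whose weighted principal minor sums of all orders from `1` to `n`
are units modulo `p`. -/
def HasUnitMinorSums (hm : m ≠ 0) (e : Fin n → ℕ)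
    (W : Matrix (Fin n) (Fin n) (ZMod (p ^ m))) : Prop :=
  ∀ k, 1 ≤ k → k ≤ n →
    weightedMinorSum p e k (W.map (ZMod.castHom (dvd_pow_self p hm) (ZMod p))) ≠ 0

theorem HasUnitMinorSums.isUnit [Fact p.Prime] (hn : 0 < n) {hm : m ≠ 0} {e : Fin n → ℕ}
    {W : Matrix (Fin n) (Fin n) (ZMod (p ^ m))} (h : HasUnitMinorSums hm e W) : IsUnit W := by
  have hp : p.Prime := Fact.out
  have : NeZero (p ^ m) := ⟨pow_ne_zero _ hp.ne_zero⟩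
  have hdet := h n hn le_rfl
  rw [weightedMinorSum_top, ← RingHom.mapMatrix_apply, ← RingHom.map_det] at hdet
  rw [Matrix.isUnit_iff_isUnit_det]
  obtain ⟨z, hz⟩ := ZMod.intCast_surjective W.det
  rw [← hz, map_intCast, Ne, ZMod.intCast_zmod_eq_zero_iff_dvd] at hdet
  rw [← hz, ZMod.coe_int_isUnit_iff_isCoprime]
  push_cast
  exact ((Prime.coprime_iff_not_dvd (Nat.prime_iff_prime_int.1 hp)).2 hdet).pow_left

open Classical in
theorem card_not_hasUnitMinorSums_mul_le [Fact p.Prime] [NeZero (p ^ m)] (hm : m ≠ 0)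
    (e : Fin n → ℕ) :
    #{W : Matrix (Fin n) (Fin n) (ZMod (p ^ m)) | ¬ HasUnitMinorSums hm e W} * p ≤
      n ^ 2 * Fintype.card (Matrix (Fin n) (Fin n) (ZMod (p ^ m))) := by
  set f := ZMod.castHom (dvd_pow_self p hm) (ZMod p) with hf
  have hsurj : Function.Surjective f.mapMatrix.toAddMonoidHom
      (α := Matrix (Fin n) (Fin n) (ZMod (p ^ m))) := fun B => by
    choose g hg using ZMod.castHom_surjective (dvd_pow_self p hm)
    exact ⟨B.map g, by ext i j; exact hg (B i j)⟩
  have hk (k : ℕ) (hkn : k ≤ n) :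
      #{W : Matrix (Fin n) (Fin n) (ZMod (p ^ m)) | weightedMinorSum p e k (W.map f) = 0} * p ≤
        n * Fintype.card (Matrix (Fin n) (Fin n) (ZMod (p ^ m))) := by
    have h1 : #{W : Matrix (Fin n) (Fin n) (ZMod (p ^ m)) |
            weightedMinorSum p e k (W.map f) = 0} *
          Fintype.card (Matrix (Fin n) (Fin n) (ZMod p)) =
        #{W : Matrix (Fin n) (Fin n) (ZMod p) | weightedMinorSum p e k W = 0} *
          Fintype.card (Matrix (Fin n) (Fin n) (ZMod (p ^ m))) := by
      convert card_filter_comp_mul_card (f.mapMatrix (m := Fin n)).toAddMonoidHom hsurj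
        (fun W => weightedMinorSum p e k W = 0)
      rfl
    have h2 := card_weightedMinorSum_eq_zero_le p e hkn
    have h3 : 0 < Fintype.card (Matrix (Fin n) (Fin n) (ZMod p)) := Fintype.card_pos
    refine Nat.le_of_mul_le_mul_right ?_ h3
    calc _ = (#{W : Matrix (Fin n) (Fin n) (ZMod (p ^ m)) |
            weightedMinorSum p e k (W.map f) = 0} *
          Fintype.card (Matrix (Fin n) (Fin n) (ZMod p))) * p := by ring
      _ = (#{W : Matrix (Fin n) (Fin n) (ZMod p) | weightedMinorSum p e k W = 0} * p) *
          Fintype.card (Matrix (Fin n) (Fin n) (ZMod (p ^ m))) := by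
        rw [h1, mul_right_comm]
      _ ≤ (k * Fintype.card (Matrix (Fin n) (Fin n) (ZMod p))) *
          Fintype.card (Matrix (Fin n) (Fin n) (ZMod (p ^ m))) := by
        gcongr
      _ ≤ (n * Fintype.card (Matrix (Fin n) (Fin n) (ZMod p))) *
          Fintype.card (Matrix (Fin n) (Fin n) (ZMod (p ^ m))) := by gcongr
      _ = _ := by ring
  have hsub : ({W | ¬ HasUnitMinorSums hm e W} :
      Finset (Matrix (Fin n) (Fin n) (ZMod (p ^ m)))) ⊆
      (Icc 1 n).biUnion fun k => {W | weightedMinorSum p e k (W.map f) = 0} := by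
    intro W hW
    have hW' := (mem_filter.1 hW).2
    unfold HasUnitMinorSums at hW'
    push Not at hW'
    obtain ⟨k, h1, h2, h3⟩ := hW'
    exact mem_biUnion.2 ⟨k, mem_Icc.2 ⟨h1, h2⟩, by simpa using h3⟩
  calc _ ≤ (∑ k ∈ Icc 1 n, #{W : Matrix (Fin n) (Fin n) (ZMod (p ^ m)) |
          weightedMinorSum p e k (W.map f) = 0}) * p :=
        Nat.mul_le_mul_right _ ((card_le_card hsub).trans card_biUnion_le)
    _ = ∑ k ∈ Icc 1 n, #{W : Matrix (Fin n) (Fin n) (ZMod (p ^ m)) |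
          weightedMinorSum p e k (W.map f) = 0} * p := sum_mul _ _ _
    _ ≤ #(Icc 1 n) • (n * Fintype.card (Matrix (Fin n) (Fin n) (ZMod (p ^ m)))) :=
        sum_le_card_nsmul _ _ _ fun k hkn => hk k (mem_Icc.1 hkn).2
    _ = _ := by rw [Nat.card_Icc, smul_eq_mul]; simp; ring

open Classical in
-- Good matrices are units, so the bound relative to all matrices passes to the smaller set of
-- units.
theorem mul_card_units_le [Fact p.Prime] [NeZero (p ^ m)] (hn : 0 < n) (hm : m ≠ 0)
    (e : Fin n → ℕ) {ε : ℝ} (hε : ε ≤ 1) (hp : (n : ℝ) ^ 2 ≤ ε * p) :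
    (1 - ε) * (Fintype.card (Matrix (Fin n) (Fin n) (ZMod (p ^ m)))ˣ : ℝ) ≤
      #{w : (Matrix (Fin n) (Fin n) (ZMod (p ^ m)))ˣ | HasUnitMinorSums hm e w.val} := by
  have hp0 : (0 : ℝ) < p := by exact_mod_cast (Fact.out : p.Prime).pos
  set N := Fintype.card (Matrix (Fin n) (Fin n) (ZMod (p ^ m))) with hN
  have hunits : Fintype.card (Matrix (Fin n) (Fin n) (ZMod (p ^ m)))ˣ ≤ N :=
    Fintype.card_le_of_injective _ Units.val_injective
  have hgood : #{W : Matrix (Fin n) (Fin n) (ZMod (p ^ m)) | HasUnitMinorSums hm e W} =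
      #{w : (Matrix (Fin n) (Fin n) (ZMod (p ^ m)))ˣ | HasUnitMinorSums hm e w.val} := by
    symm
    refine card_bij (fun w _ => w.val) (fun w hw => by simpa using hw)
      (fun _ _ _ _ h => Units.val_injective h) fun W hW => ?_
    have hW' : HasUnitMinorSums hm e W := by simpa using hW
    obtain ⟨w, rfl⟩ := hW'.isUnit hn
    exact ⟨w, by simpa using hW', rfl⟩
  have hsplit := card_filter_add_card_filter_not
    (s := (univ : Finset (Matrix (Fin n) (Fin n) (ZMod (p ^ m))))) (HasUnitMinorSums hm e)
  rw [Finset.card_univ, ← hN] at hsplit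
  have hbad : (#{W : Matrix (Fin n) (Fin n) (ZMod (p ^ m)) | ¬ HasUnitMinorSums hm e W} : ℝ) ≤
      ε * N := by
    have h1 : (#{W : Matrix (Fin n) (Fin n) (ZMod (p ^ m)) | ¬ HasUnitMinorSums hm e W} : ℝ) *
        p ≤ (n : ℝ) ^ 2 * N := by exact_mod_cast card_not_hasUnitMinorSums_mul_le hm e
    refine le_of_mul_le_mul_right (h1.trans ?_) hp0
    calc (n : ℝ) ^ 2 * N ≤ ε * p * N := by gcongr
      _ = ε * N * p := by ring
  have hsplit' : (#{W : Matrix (Fin n) (Fin n) (ZMod (p ^ m)) | HasUnitMinorSums hm e W} : ℝ) +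
      #{W : Matrix (Fin n) (Fin n) (ZMod (p ^ m)) | ¬ HasUnitMinorSums hm e W} = N := by
    exact_mod_cast hsplit
  have h2 : (1 - ε) * (Fintype.card (Matrix (Fin n) (Fin n) (ZMod (p ^ m)))ˣ : ℝ) ≤
      (1 - ε) * N :=
    mul_le_mul_of_nonneg_left (by exact_mod_cast hunits) (by linarith)
  rw [← hgood]
  linarith

/-- The diagonal matrix with entries `p ^ e i` modulo `p ^ m`. -/
def diagonalPow (p m : ℕ) (e : Fin n → ℕ) : Matrix (Fin n) (Fin n) (ZMod (p ^ m)) :=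
  Matrix.diagonal fun i => (p : ZMod (p ^ m)) ^ e i

/-- Each `s i` is `p ^ e i` times an integer prime to `p`; these cofactors are absorbed into the
left unit. -/
theorem map_mem_unitOrbit [NeZero (p ^ m)] (hp : p.Prime) {e : Fin n → ℕ}
    {A : Matrix (Fin n) (Fin n) ℤ} {s : Fin n → ℤ} (hA : IsSmithForm A s)
    (hs : ∀ i, emultiplicity (p : ℤ) (s i) = e i) :
    A.map (Int.castRingHom (ZMod (p ^ m))) ∈ unitOrbit (diagonalPow p m e) := by
  obtain ⟨-, -, U, V, hU, hV, rfl⟩ := hA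
  choose u hu using fun i => (emultiplicity_eq_coe.1 (hs i)).1
  have hunit (i : Fin n) : ¬ (p : ℤ) ∣ u i := fun ⟨w, hw⟩ =>
    (emultiplicity_eq_coe.1 (hs i)).2 ⟨w, by rw [hu i, hw]; ring⟩
  set φ := (Int.castRingHom (ZMod (p ^ m))).mapMatrix (m := Fin n) with hφ
  have hU' : IsUnit (φ U) := ((Matrix.isUnit_iff_isUnit_det _).2 hU).map φ
  have hV' : IsUnit (φ V) := ((Matrix.isUnit_iff_isUnit_det _).2 hV).map φ
  have hD : IsUnit (φ (Matrix.diagonal u)) := by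
    rw [Matrix.isUnit_iff_isUnit_det, hφ, ← RingHom.map_det, Matrix.det_diagonal, eq_intCast,
      ZMod.coe_int_isUnit_iff_isCoprime]
    push_cast
    exact (IsCoprime.prod_right fun i _ => (Prime.coprime_iff_not_dvd
      (Nat.prime_iff_prime_int.1 hp)).2 (hunit i)).pow_left
  rw [mem_unitOrbit]
  refine ⟨(hU'.mul hD).unit, hV'.unit, ?_⟩
  have hdiag : Matrix.diagonal s =
      Matrix.diagonal u * Matrix.diagonal (fun i => (p : ℤ) ^ e i) := by
    rw [Matrix.diagonal_mul_diagonal]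
    congr 1
    ext i
    rw [hu i, mul_comm]
  have hS : φ (Matrix.diagonal (fun i => (p : ℤ) ^ e i)) = diagonalPow p m e := by
    rw [hφ, RingHom.mapMatrix_apply, Matrix.diagonal_map (map_zero _), diagonalPow]
    congr 1
    ext i
    simp
  change φ U * φ (Matrix.diagonal u) * diagonalPow p m e * φ V =
    φ (U * Matrix.diagonal s * V)
  rw [hdiag, map_mul, map_mul, map_mul, hS]
  simp only [Matrix.mul_assoc]

theorem emultiplicity_eq_of_map_mem_unitOrbit [NeZero (p ^ m)] (hp : p.Prime) (hm : m ≠ 0)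
    {e : Fin n → ℕ} (he : Monotone e) (hem : ∀ i, e i < m) {A : Matrix (Fin n) (Fin n) ℤ}
    {s : Fin n → ℤ} (hA : IsSmithForm A s)
    (h : A.map (Int.castRingHom (ZMod (p ^ m))) ∈ unitOrbit (diagonalPow p m e)) (i : Fin n) :
    emultiplicity (p : ℤ) (s i) = e i := by
  obtain ⟨-, hchain, U, V, hU, hV, rfl⟩ := hA
  obtain ⟨u, v, huv⟩ := mem_unitOrbit.1 h
  set φ := (Int.castRingHom (ZMod (p ^ m))).mapMatrix (m := Fin n) with hφ
  obtain ⟨U', hU'⟩ : IsUnit (φ U) := ((Matrix.isUnit_iff_isUnit_det _).2 hU).map φ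
  obtain ⟨V', hV'⟩ : IsUnit (φ V) := ((Matrix.isUnit_iff_isUnit_det _).2 hV).map φ
  have hmul : (u : Matrix (Fin n) (Fin n) (ZMod (p ^ m))) * diagonalPow p m e * v =
      U' * φ (Matrix.diagonal s) * V' := by
    rw [huv, hU', hV', ← map_mul, ← map_mul]
    rfl
  have hmul' : φ (Matrix.diagonal s) * (V' * v⁻¹ : (Matrix (Fin n) (Fin n) (ZMod (p ^ m)))ˣ) =
      (U'⁻¹ * u : (Matrix (Fin n) (Fin n) (ZMod (p ^ m)))ˣ) * diagonalPow p m e := by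
    rw [Units.val_mul, Units.val_mul, ← mul_assoc, Units.mul_inv_eq_iff_eq_mul, mul_assoc,
      mul_assoc, Units.eq_inv_mul_iff_mul_eq, ← mul_assoc, ← mul_assoc, ← hmul]
  refine emultiplicity_eq_of_diagonal_mul_modEq (m := m) hp hchain he hem
    (X := residueLift (V' * v⁻¹ : (Matrix (Fin n) (Fin n) (ZMod (p ^ m)))ˣ).val)
    (Y := residueLift (U'⁻¹ * u : (Matrix (Fin n) (Fin n) (ZMod (p ^ m)))ˣ).val)
    (not_dvd_det_of_isUnit_map hp hm (by rw [residueLift_map]; exact Units.isUnit _))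
    (not_dvd_det_of_isUnit_map hp hm (by rw [residueLift_map]; exact Units.isUnit _))
    (fun a b => ?_) i
  have hab := congrFun (congrFun hmul' a) b
  rw [hφ, RingHom.mapMatrix_apply, Matrix.diagonal_map (map_zero _), Matrix.diagonal_mul,
    diagonalPow, Matrix.mul_diagonal] at hab
  have := (ZMod.intCast_zmod_eq_zero_iff_dvd (s a * residueLift
    (V' * v⁻¹ : (Matrix (Fin n) (Fin n) (ZMod (p ^ m)))ˣ).val a b - residueLift
    (U'⁻¹ * u : (Matrix (Fin n) (Fin n) (ZMod (p ^ m)))ˣ).val a b * (p : ℤ) ^ e b) (p ^ m)).1 (by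
      rw [eq_intCast] at hab
      simp only [residueLift, Matrix.map_apply]
      rw [Int.cast_sub, Int.cast_mul, Int.cast_mul, Int.cast_pow, Int.cast_natCast,
        Int.cast_natCast, Int.cast_natCast, ZMod.natCast_zmod_val, ZMod.natCast_zmod_val,
        sub_eq_zero]
      exact hab)
  exact_mod_cast this

theorem emultiplicity_eq_of_dvd_sub {a b : ℤ} {c : ℕ} (hcm : c < m)
    (hab : (p : ℤ) ^ m ∣ a - b) (hb : emultiplicity (p : ℤ) b = c) :
    emultiplicity (p : ℤ) a = c := by
  rw [emultiplicity_eq_coe] at hb ⊢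
  exact ⟨(dvd_iff_dvd_of_dvd_sub ((pow_dvd_pow _ hcm.le).trans hab)).2 hb.1,
    fun h => hb.2 ((dvd_iff_dvd_of_dvd_sub ((pow_dvd_pow _ hcm).trans hab)).1 h)⟩

/-- The lift is compared modulo `p ^ m` with `S` times a lift of `v u`. The latter coefficient has
valuation `initialSum e k < m`, which the congruence preserves. -/
theorem emultiplicity_charpoly_coeff_residueLift [Fact p.Prime] [NeZero (p ^ m)] (hm : m ≠ 0)
    {e : Fin n → ℕ} (he : Monotone e) (hem : ∑ i, e i < m)
    {u v : (Matrix (Fin n) (Fin n) (ZMod (p ^ m)))ˣ}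
    (h : HasUnitMinorSums hm e (v.val * u.val)) {k : ℕ}
    (hk : 1 ≤ k) (hkn : k ≤ n) :
    emultiplicity (p : ℤ)
      ((residueLift (u.val * diagonalPow p m e * v.val)).charpoly.coeff (n - k)) =
      initialSum e k := by
  have hp : p.Prime := Fact.out
  have hp' : Prime (p : ℤ) := Nat.prime_iff_prime_int.1 hp
  set W := residueLift (v.val * u.val) with hW
  have hlt : initialSum e k < m :=
    (Finset.sum_le_sum_of_subset (Finset.filter_subset _ _)).trans_lt hem
  refine emultiplicity_eq_of_dvd_sub
    (b := (Matrix.diagonal (fun i => (p : ℤ) ^ e i) * W).charpoly.coeff (n - k)) hlt ?_ ?_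
  · have hchar : ((residueLift (u.val * diagonalPow p m e * v.val)).charpoly.map
        (Int.castRingHom (ZMod (p ^ m)))) =
        (Matrix.diagonal (fun i => (p : ℤ) ^ e i) * W).charpoly.map
          (Int.castRingHom (ZMod (p ^ m))) := by
      rw [← Matrix.charpoly_map, ← Matrix.charpoly_map, residueLift_map, Matrix.map_mul, hW,
        residueLift_map, Matrix.diagonal_map (map_zero _), mul_assoc, Matrix.charpoly_mul_comm,
        mul_assoc]
      congr 3
      simp [diagonalPow]
    have hc := congrArg (fun q => q.coeff (n - k)) hchar
    simp only [Polynomial.coeff_map, eq_intCast] at hc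
    have := (ZMod.intCast_eq_intCast_iff_dvd_sub _ _ _).1 hc.symm
    exact_mod_cast this
  · rw [charpoly_coeff_diagonal_mul p he hkn]
    have hnd : ¬ (p : ℤ) ∣ weightedMinorSum p e k W := by
      have h1 := h k hk hkn
      rw [← residueLift_map (v.val * u.val), ← hW,
        Matrix.map_map, ← RingHom.coe_comp, ← map_weightedMinorSum] at h1
      intro hdvd
      apply h1
      rw [eq_intCast, ZMod.intCast_zmod_eq_zero_iff_dvd]
      exact hdvd
    rw [emultiplicity_mul hp', emultiplicity_mul hp', emultiplicity_pow_self
      hp'.ne_zero hp'.not_isUnit, emultiplicity_eq_zero.2 hnd, emultiplicity_eq_zero.2]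
    · simp
    · exact fun hd => hp'.not_isUnit (isUnit_of_dvd_unit hd (isUnit_one.neg.pow k))

theorem smithClass_eq_image [NeZero (p ^ m)] (hp : p.Prime) (hm : m ≠ 0) {e : Fin n → ℕ}
    (he : Monotone e) (hem : ∀ i, e i < m) :
    smithClass p m e =
    residueLift '' (unitOrbit (diagonalPow p m e) : Set (Matrix (Fin n) (Fin n) (ZMod (p ^ m)))) := by
  ext A
  constructor
  · rintro ⟨hA, s, hs, hse⟩
    exact ⟨_, map_mem_unitOrbit hp hs hse, residueLift_of_map (by exact_mod_cast hA)⟩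
  · rintro ⟨B, hB, rfl⟩
    refine ⟨fun i j => ⟨Int.natCast_nonneg _, ?_⟩, ?_⟩
    · have := ZMod.val_lt (B i j)
      simp only [residueLift, Matrix.map_apply]
      exact_mod_cast this
    · obtain ⟨s, hs⟩ := exists_isSmithForm (residueLift B)
      exact ⟨s, hs, emultiplicity_eq_of_map_mem_unitOrbit hp hm he hem hs
        (by rw [residueLift_map]; exact hB)⟩

theorem det_ne_zero_of_mem_smithClass {e : Fin n → ℕ} {A : Matrix (Fin n) (Fin n) ℤ}
    (hA : A ∈ smithClass p m e) : A.det ≠ 0 := by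
  obtain ⟨-, s, hs, hse⟩ := hA
  refine hs.det_ne_zero fun i hi => ?_
  have := hse i
  rw [hi, emultiplicity_zero] at this
  exact ENat.natCast_ne_top _ this.symm

end Residues

/-! ### The density bound -/

theorem theorem2 (n : ℕ) (hn : 0 < n) (ε : ℝ) (hε : 0 < ε) (p : ℕ) [Fact p.Prime]
    (hp : 16 * ((n : ℝ) ^ 2 + 3 * (n : ℝ)) / ε < (p : ℝ))
    (e : Fin n → ℕ) (he : Monotone e) (m : ℕ) (hm : (∑ i, e i) + 1 ≤ m) :
    (1 - ε) * ((smithClass p m e).ncard : ℝ) ≤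
        (({A ∈ smithClass p m e | IsPCharacterized p A ∧ IsPCorrespondent p A}).ncard : ℝ) ∧
      ∀ A ∈ smithClass p m e, IsPCharacterized p A → IsPCorrespondent p A := by
  classical
  have hprime : p.Prime := Fact.out
  have hcorr : ∀ A ∈ smithClass p m e, IsPCharacterized p A → IsPCorrespondent p A :=
    fun A hA h => h.isPCorrespondent (det_ne_zero_of_mem_smithClass hA)
  refine ⟨?_, hcorr⟩
  -- For `ε > 1` the left side is nonpositive; otherwise `1 - ε ≥ 0`, as the passage to units needs.
  rcases lt_or_ge 1 ε with hε1 | hε1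
  · exact (mul_nonpos_of_nonpos_of_nonneg (by linarith) (Nat.cast_nonneg _)).trans
      (Nat.cast_nonneg _)
  have hm0 : m ≠ 0 := by omega
  have : NeZero (p ^ m) := ⟨pow_ne_zero _ hprime.ne_zero⟩
  have hem : ∀ i, e i < m := fun i =>
    (Finset.single_le_sum (fun j _ => Nat.zero_le (e j)) (Finset.mem_univ i)).trans_lt hm
  -- The union bound only needs this consequence of the lower bound on `p`.
  have hnp : (n : ℝ) ^ 2 ≤ ε * p := by
    rw [div_lt_iff₀ hε] at hp
    have : (0 : ℝ) ≤ n := Nat.cast_nonneg n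
    nlinarith
  have himage := smithClass_eq_image hprime hm0 he hem
  have hcard : (smithClass p m e).ncard = (unitOrbit (diagonalPow p m e)).card := by
    rw [himage, Set.ncard_image_of_injective _ residueLift_injective, Set.ncard_coe_finset]
  have hgood : ((unitOrbit (diagonalPow p m e)).filter
      fun B => IsPCharacterized p (residueLift B)).card ≤
      {A ∈ smithClass p m e | IsPCharacterized p A ∧ IsPCorrespondent p A}.ncard := by
    rw [← Set.ncard_coe_finset, ← Set.ncard_image_of_injective _ residueLift_injective]
    refine Set.ncard_le_ncard ?_ ((smithClass_finite p m e).subset fun A hA => hA.1)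
    rintro _ ⟨B, hB, rfl⟩
    obtain ⟨hB, hchar⟩ := Finset.mem_filter.1 hB
    have hmem : residueLift B ∈ smithClass p m e := by
      rw [himage]
      exact ⟨B, hB, rfl⟩
    exact ⟨hmem, hchar, hcorr _ hmem hchar⟩
  rw [hcard]
  refine (mul_card_unitOrbit_le (diagonalPow p m e) (P := HasUnitMinorSums hm0 e)
    (Q := fun B => IsPCharacterized p (residueLift B)) (fun u v huv => ?_)
    (mul_card_units_le hn hm0 e hε1 hnp)).trans (by exact_mod_cast hgood)
  obtain ⟨s, hs⟩ := exists_isSmithForm (residueLift (u.val * diagonalPow p m e * v.val))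
  have hse := emultiplicity_eq_of_map_mem_unitOrbit hprime hm0 he hem hs
    (by rw [residueLift_map]; exact mem_unitOrbit.2 ⟨u, v, rfl⟩)
  refine ⟨s, hs, fun k hk hkr => ?_⟩
  rw [emultiplicity_prod_initial hprime hse]
  exact emultiplicity_charpoly_coeff_residueLift hm0 he hm huv hk
    (hkr.trans (Matrix.rank_le_width _))
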